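/- **Setting.** Let $\mathcal V$ be a finite nonempty vocabulary and let $0<\gamma<1$. A *token state* $s=\{\mathbf x,\mathbf y_{<t}\}$ is a prompt and a partial response, both finite strings over $\mathcal V$; for $y\in\mathcal V$, $s\oplus y$ appends $y$ to the response. Let $\mathcal C_{\text{task}}(s,y)\in[0,\infty)$ and $\mathcal C_{\text{safety}}(s,y)\in\mathbb R$ be arbitrary task and safety costs. The *augmented token-space MDP* has the states $(s,z)$, $z\in\mathbb R$ (the remaining safety budget, rescaled), the actions $y\in\mathcal V$, the deterministic transitions $(s,z)\mapsto\big(s\oplus y,\ (z-\mathcal C_{\text{safety}}(s,y))/\gamma\big)$, and, for a penalty $n\in\mathbb N\cup\{\infty\}$, the cost $\tilde{\mathcal C}^n(s,z,y)=\mathcal C_{\text{task}}(s,y)$ if $z>0$ and $\tilde{\mathcal C}^n(s,z,y)=n$ if $z\le 0$. Let $\mathsf H,\mathsf O$ be separable metrizable spaces with their Borel $\sigma$-algebras (hidden states and logits). A *latent representation* consists of a map $\phi$ from token states to $\mathsf H\times\mathsf O$, cost functions $\bar{\mathcal C}^n:\mathsf H\times\mathsf O\times\mathbb R\times\mathcal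 V\to[0,\infty]$, $n\in\mathbb N\cup\{\infty\}$, and a Markov kernel $\bar{\mathcal P}$ from $\mathsf H\times\mathsf O\times\mathbb R\times\mathcal V$ to $\mathsf H\times\mathsf O\times\mathbb R$ such that for all $(s,z)$ and $y$, $\bar{\mathcal C}^n(\phi(s),z,y)=\tilde{\mathcal C}^n(s,z,y)$, and $\bar{\mathcal P}(\cdot\mid\phi(s),z,y)$ is the image of the token-space transition law at $((s,z),y)$ under $(s',z')\mapsto(\phi(s'),z')$. The costs $\bar{\mathcal C}^n(\ell,y)$, $n\in\mathbb N$, are nondecreasing in $n$ with limit $\bar{\mathcal C}^\infty(\ell,y)$, for every latent state $\ell=(h,o,z)$ and every $y$. A *policy* is a stationary, possibly randomized one, i.e. a Markov kernel from states to $\mathcal V$. For a latent policy $\bar\pi$ let $\bar V^n(\bar\pi,\ell)=\mathbb E_{\bar\pi}\big[\sum_{t\ge0}\gamma^t\,\bar{\mathcal C}^n(\ell_t,y_t)\mid \ell_0=\ell\big]\in[0,\infty]$ and $\bar V^{*,n}(\ell)=\inf_{\bar\pi}\bar V^n(\bar\pi,\ell)$; $\bar\pi$ is *optimal for $n$* if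 $\bar V^n(\bar\pi,\ell)=\bar V^{*,n}(\ell)$ for all $\ell$. The policy $\bar\pi\circ\phi$ in token space plays $\bar\pi(\cdot\mid\phi(s),z)$ in the state $(s,z)$; $V^n(\pi,(s,z))$ denotes the value of a policy $\pi$ in the augmented token-space MDP with the cost $\tilde{\mathcal C}^n$. **Theorem 1 (Optimality in the latent space).** Assume * **A1.** for every finite $n$, $\bar{\mathcal C}^n$ is bounded, measurable, nonnegative, and, for each fixed $y$, lower semicontinuous in the latent state $(h,o,z)$ on $\{z>0\}$ and on $\{z\le0\}$ (it may jump across $z=0$); * **A2.** $\bar{\mathcal P}$ is weakly continuous for each $y$: $\ell\mapsto\int u\,d\bar{\mathcal P}(\cdot\mid\ell,y)$ is continuous for every bounded continuous $u$. Then: (a) For every finite $n$, $\bar V^{*,n}$ is finite-valued and measurable and satisfies the Bellman optimality equation $$\bar V^{*,n}(\ell)=\min_{y\in\mathcal V}\Big(\bar{\mathcal C}^n(\ell,y)+\gamma\int\bar V^{*,n}(\ell')\,\bar{\mathcal P}(d\ell'\mid\ell,y)\Big)\qquad\text{for all }\ell,$$ and there is an optimal stationary policy for $n$, which can be chosen deterministic;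 for $n=\infty$ there is one as well. (b) For every latent state $\ell$, $\bar V^{*,n}(\ell)$ is nondecreasing in $n\in\mathbb N$ and converges to $\bar V^{*,\infty}(\ell)$ as $n\to\infty$. (c) For each $n\in\mathbb N\cup\{\infty\}$ let $\bar\pi^{*,n}$ be any latent policy that is optimal for $n$. Then for every augmented token state $(s,z)$ and every $n\in\mathbb N\cup\{\infty\}$, $$V^n(\bar\pi^{*,n}\circ\phi,(s,z))=\min_{\bar\pi}V^n(\bar\pi\circ\phi,(s,z)),$$ the minimum being over all latent policies $\bar\pi$; and as $n\to\infty$ through $\mathbb N$ these values increase to $V^\infty(\bar\pi^{*,\infty}\circ\phi,(s,z))$, the minimum for the infinite penalty. -/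

import Mathlib

open MeasureTheory ProbabilityTheory Filter Topology
open scoped NNReal ENNReal

noncomputable section

namespace SafeLatent

/-! ### Discounted Markov decision processes with costs in `[0, ∞]` -/

/-- A stationary (possibly randomized) policy: a measurable family `π(· | s)` of probability
distributions over the actions, indexed by the states. -/
abbrev Policy (S A : Type*) [MeasurableSpace S] [MeasurableSpace A] :=
  {π : Kernel S A // IsMarkovKernel π}

instance instIsMarkovKernelPolicy {S A : Type*} [MeasurableSpace S] [MeasurableSpace A]
    (π : Policy S A) : IsMarkovKernel π.1 := π.2

/-- The deterministic stationary policy that plays the action `f s` in the state `s`. -/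
def Policy.ofFun {S A : Type*} [MeasurableSpace S] [MeasurableSpace A] (f : S → A)
    (hf : Measurable f) : Policy S A :=
  ⟨Kernel.deterministic f hf, inferInstance⟩

/-- The policy `π ∘ g` on `S'`: in the state `s'` draw the action from `π(· | g s')`. -/
def Policy.pullback {S S' A : Type*} [MeasurableSpace S] [MeasurableSpace S'] [MeasurableSpace A]
    (π : Policy S A) (g : S' → S) (hg : Measurable g) : Policy S' A :=
  ⟨π.1.comap g hg, inferInstance⟩

/-- Complete a state `s` to a state-action pair `(s, a)` with `a ∼ π(· | s)`. -/
def actKernel {S A : Type*} [MeasurableSpace S] [MeasurableSpace A] (π : Policy S A) :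
    Kernel S (S × A) :=
  Kernel.id ×ₖ π.1

instance instIsMarkovKernelActKernel {S A : Type*} [MeasurableSpace S] [MeasurableSpace A]
    (π : Policy S A) : IsMarkovKernel (actKernel π) := by
  unfold actKernel; infer_instance

/-- The law of `(s_{t+1}, a_{t+1})` given the past `(s_i, a_i)`, `i ≤ t`:
`s_{t+1} ∼ P(· | s_t, a_t)` and `a_{t+1} ∼ π(· | s_{t+1})`. -/
def nextKernel {S A : Type*} [MeasurableSpace S] [MeasurableSpace A] (P : Kernel (S × A) S)
    (π : Policy S A) (t : ℕ) : Kernel (Finset.Iic t → S × A) (S × A) :=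
  (actKernel π ∘ₖ P).comap (fun past => past ⟨t, Finset.mem_Iic.2 le_rfl⟩)
    (measurable_pi_apply _)

instance instIsMarkovKernelNextKernel {S A : Type*} [MeasurableSpace S] [MeasurableSpace A]
    (P : Kernel (S × A) S) [IsMarkovKernel P] (π : Policy S A) (t : ℕ) :
    IsMarkovKernel (nextKernel P π t) := by
  unfold nextKernel; infer_instance

/-- The law of the whole trajectory `(s_t, a_t)_{t ≥ 0}` started in `s_0 = s`, when actions are
drawn from `π` and transitions from `P`. -/
def trajLaw {S A : Type*} [MeasurableSpace S] [MeasurableSpace A] (P : Kernel (S × A) S)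
    [IsMarkovKernel P] (π : Policy S A) (s : S) : Measure (ℕ → S × A) :=
  Kernel.trajMeasure (X := fun _ => S × A) (actKernel π s) (nextKernel P π)

/-- The value `E_π [∑_{t ≥ 0} γ ^ t c(s_t, a_t)]` of the policy `π` from the initial state `s`. -/
def value {S A : Type*} [MeasurableSpace S] [MeasurableSpace A] (P : Kernel (S × A) S)
    [IsMarkovKernel P] (γ : ℝ≥0) (c : S → A → ℝ≥0∞) (π : Policy S A) (s : S) : ℝ≥0∞ :=
  ∫⁻ ω, ∑' t : ℕ, (γ : ℝ≥0∞) ^ t * c (ω t).1 (ω t).2 ∂(trajLaw P π s)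

/-- The optimal value `V*(s) = inf_π V(π, s)`. -/
def optValue {S A : Type*} [MeasurableSpace S] [MeasurableSpace A] (P : Kernel (S × A) S)
    [IsMarkovKernel P] (γ : ℝ≥0) (c : S → A → ℝ≥0∞) (s : S) : ℝ≥0∞ :=
  ⨅ π : Policy S A, value P γ c π s

/-- `π` is an optimal policy: it attains the optimal value from every initial state. -/
def IsOptimal {S A : Type*} [MeasurableSpace S] [MeasurableSpace A] (P : Kernel (S × A) S)
    [IsMarkovKernel P] (γ : ℝ≥0) (c : S → A → ℝ≥0∞) (π : Policy S A) : Prop :=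
  ∀ s, value P γ c π s = optValue P γ c s

/-! ### The safety-augmented token-space process -/

/-- A token state: a prompt `x` and the partial response `y_{<t}` decoded so far, both of them
strings over the vocabulary `V`. -/
structure TokenState (V : Type*) where
  prompt : List V
  response : List V

instance instMeasurableSpaceTokenState (V : Type*) : MeasurableSpace (TokenState V) := ⊤

/-- The original transition `s ⊕ y`: append the generated token to the partial response. -/
def TokenState.append {V : Type*} (s : TokenState V) (y : V) : TokenState V :=
  ⟨s.prompt, s.response ++ [y]⟩

/-- An augmented token state: a token state with the value `z` of the constraint tracker. -/
abbrev AugState (V : Type*) := TokenState V × ℝ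

/-- One step of the augmented dynamics: `s' = s ⊕ y` and `z' = (z - C_safety(s, y)) / γ`. -/
def augStep {V : Type*} (γ : ℝ≥0) (Csafety : TokenState V → V → ℝ) (p : AugState V × V) :
    AugState V :=
  (p.1.1.append p.2, (p.1.2 - Csafety p.1.1 p.2) / (γ : ℝ))

lemma measurable_augStep {V : Type*} [Finite V] [MeasurableSpace V] [MeasurableSingletonClass V]
    (γ : ℝ≥0) (Csafety : TokenState V → V → ℝ) : Measurable (augStep γ Csafety) := by
  have hC : Measurable (fun q : TokenState V × V => Csafety q.1 q.2) :=
    measurable_from_prod_countable_left fun _ _ _ => trivial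
  have hA : Measurable (fun q : TokenState V × V => q.1.append q.2) :=
    measurable_from_prod_countable_left fun _ _ _ => trivial
  have hq : Measurable (fun p : AugState V × V => (p.1.1, p.2)) := by fun_prop
  have h1 := hC.comp hq
  exact (hA.comp hq).prodMk ((measurable_fst.snd.sub h1).div_const _)

/-- The (deterministic) transition kernel of the augmented token-space process. -/
def augKernel {V : Type*} [Finite V] [MeasurableSpace V] [MeasurableSingletonClass V] (γ : ℝ≥0)
    (Csafety : TokenState V → V → ℝ) : Kernel (AugState V × V) (AugState V) :=
  Kernel.deterministic (augStep γ Csafety) (measurable_augStep γ Csafety)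

instance instIsMarkovKernelAugKernel {V : Type*} [Finite V] [MeasurableSpace V]
    [MeasurableSingletonClass V] (γ : ℝ≥0) (Csafety : TokenState V → V → ℝ) :
    IsMarkovKernel (augKernel γ Csafety) := by
  unfold augKernel; infer_instance

/-- The reshaped task cost with penalty `n ∈ ℕ ∪ {∞}`: the task cost as long as `z > 0`, and
`n` as soon as `z ≤ 0`. -/
def augCost {V : Type*} (Ctask : TokenState V → V → ℝ≥0) (n : ℕ∞) (p : AugState V) (y : V) :
    ℝ≥0∞ :=
  if 0 < p.2 then (Ctask p.1 y : ℝ≥0∞) else (n : ℝ≥0∞)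

/-! ### The latent process -/

/-- A latent state `((h, o), z)`: a hidden state, logits, and the constraint tracker. -/
abbrev LatentState (H O : Type*) := (H × O) × ℝ

/-- The embedding `[s, z] ↦ [φ(s), z]` of augmented token states. -/
def embed {V H O : Type*} (φ : TokenState V → H × O) (p : AugState V) : LatentState H O :=
  (φ p.1, p.2)

lemma measurable_embed {V H O : Type*} [MeasurableSpace H] [MeasurableSpace O]
    (φ : TokenState V → H × O) : Measurable (embed φ) := by
  have hφ : Measurable φ := fun _ _ => trivial
  exact (hφ.comp measurable_fst).prodMk measurable_snd

/-- The requirements on a latent cost at a finite penalty: it is (nonnegative and) bounded,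
measurable, and for a fixed action lower semicontinuous in the latent state on the safe region
`z > 0` and on the unsafe region `z ≤ 0`. A cost that is lower semicontinuous on the whole latent
space is so on both regions; a jump of the cost at `z = 0`, as in `augCost`, is allowed. -/
structure IsRegularCost {H O V : Type*} [TopologicalSpace H] [TopologicalSpace O]
    [MeasurableSpace H] [MeasurableSpace O] (c : LatentState H O → V → ℝ≥0∞) : Prop where
  bounded : ∃ M : ℝ≥0, ∀ l y, c l y ≤ M
  measurable : ∀ y, Measurable fun l => c l y
  lsc_safe : ∀ y, LowerSemicontinuousOn (fun l => c l y) {l | 0 < l.2}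
  lsc_unsafe : ∀ y, LowerSemicontinuousOn (fun l => c l y) {l | l.2 ≤ 0}

/-- Weak continuity of a transition law in the state, for each fixed action: integrals of bounded
continuous functions depend continuously on the state. -/
def WeaklyContinuous {S A : Type*} [TopologicalSpace S] [MeasurableSpace S] [MeasurableSpace A]
    (P : Kernel (S × A) S) : Prop :=
  ∀ (a : A) (u : BoundedContinuousFunction S ℝ), Continuous fun s => ∫ s', u s' ∂(P (s, a))

/-- `φ`, the latent costs `C̄ n` and the latent transition law `P̄` represent the augmented token
process: embedded augmented states have the same costs, and the latent transition law at an
embedded state is the image under the embedding of the transition law in token space. -/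
structure Represents {V H O : Type*} [Finite V] [MeasurableSpace V] [MeasurableSingletonClass V]
    [MeasurableSpace H] [MeasurableSpace O] (γ : ℝ≥0) (Ctask : TokenState V → V → ℝ≥0)
    (Csafety : TokenState V → V → ℝ) (φ : TokenState V → H × O)
    (Cbar : ℕ∞ → LatentState H O → V → ℝ≥0∞)
    (Pbar : Kernel (LatentState H O × V) (LatentState H O)) : Prop where
  cost_eq : ∀ (n : ℕ∞) (p : AugState V) (y : V), Cbar n (embed φ p) y = augCost Ctask n p y
  transition_eq : ∀ (p : AugState V) (y : V),
    Pbar (embed φ p, y) = (augKernel γ Csafety (p, y)).map (embed φ)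

end SafeLatent

end

/-!
The vocabulary is finite, so the whole theory of the latent decision process runs on monotone
convergence in `[0, ∞]`, in the same way for every penalty `n ∈ ℕ ∪ {∞}`.

By the Markov property the value of a stationary policy `π` is the sum over the stages `t` of the
`t`-th iterate of a one-step expectation operator (`value_eq_tsum`). It follows that the value of
`π` solves the Bellman equation of `π` (`value_eq_lintegral`) and lies below every function that
satisfies this equation with `≤` (`value_le_of_supersolution`).

The optimality operator `bellman` takes a minimum over finitely many actions. Such a minimum has a
measurable selection and commutes with increasing suprema, whence `bellman_iSup`. Value iteration
from `0` therefore increases to a measurable fixed point `v`. It lies below the value of every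
policy, and the value of a policy that is greedy for `v` is at most `v`. So `v` is the optimal value
and the greedy policy is optimal (`optValue_eq_iSup_iterate`, `exists_isOptimal_ofFun`). Boundedness
of the cost enters only to make the optimal value finite.

When the costs increase to a limit, the supremum of their optimal values solves the optimality
equation of the limiting cost and so dominates its optimal value; the reverse inequality is
monotonicity (`optValue_iSup`). This is the convergence as `n → ∞`.

The embedding of token states is a homomorphism of decision processes, so a latent policy and its
pullback to token space have the same value (`value_pullback`), and the claims in token space are
those for the latent values at embedded states.
-/

namespace SafeLatent

/-! ### The value of a policy as a sum over stages -/

section Value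

variable {S A : Type*} [MeasurableSpace S] [MeasurableSpace A]

/-- The one-step conditional expectation operator of the state-action chain under the policy `π`:
`g` is sent to `p ↦ E[g (s_{t+1}, a_{t+1}) | (s_t, a_t) = p]`. -/
noncomputable def expNext (P : Kernel (S × A) S) (π : Policy S A) (g : S × A → ℝ≥0∞) :
    S × A → ℝ≥0∞ :=
  fun p => ∫⁻ q, g q ∂((actKernel π ∘ₖ P) p)

lemma lintegral_actKernel (π : Policy S A) {g : S × A → ℝ≥0∞} (hg : Measurable g) (s : S) :
    ∫⁻ q, g q ∂(actKernel π s) = ∫⁻ a, g (s, a) ∂(π.1 s) :=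
  Kernel.lintegral_id_prod hg _ _

lemma expNext_apply (P : Kernel (S × A) S) (π : Policy S A) {g : S × A → ℝ≥0∞}
    (hg : Measurable g) (p : S × A) :
    expNext P π g p = ∫⁻ s, ∫⁻ a, g (s, a) ∂(π.1 s) ∂(P p) := by
  rw [expNext, Kernel.lintegral_comp _ _ _ hg]
  simp_rw [lintegral_actKernel π hg]

lemma measurable_expNext (P : Kernel (S × A) S) (π : Policy S A) {g : S × A → ℝ≥0∞}
    (hg : Measurable g) : Measurable (expNext P π g) :=
  hg.lintegral_kernel

lemma measurable_iterate_expNext (P : Kernel (S × A) S) (π : Policy S A) {g : S × A → ℝ≥0∞}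
    (hg : Measurable g) (t : ℕ) : Measurable ((expNext P π)^[t] g) := by
  induction t with
  | zero => exact hg
  | succ t ih => rw [Function.iterate_succ_apply']; exact measurable_expNext P π ih

lemma measurable_lintegral_policy (π : Policy S A) {g : S × A → ℝ≥0∞} (hg : Measurable g) :
    Measurable fun s => ∫⁻ a, g (s, a) ∂(π.1 s) :=
  hg.lintegral_kernel_prod_right'

variable (P : Kernel (S × A) S) [IsMarkovKernel P] (π : Policy S A)

instance instIsProbabilityMeasureTrajLaw (s : S) : IsProbabilityMeasure (trajLaw P π s) := by
  unfold trajLaw; infer_instance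

/-- The Markov property, integrated: the trajectory law at time `t + 1` is obtained from the one
at time `t` by one step of the state-action chain. -/
lemma lintegral_trajLaw_succ (s : S) {g : S × A → ℝ≥0∞} (hg : Measurable g) (t : ℕ) :
    ∫⁻ ω, g (ω (t + 1)) ∂(trajLaw P π s) = ∫⁻ ω, expNext P π g (ω t) ∂(trajLaw P π s) := by
  have h := Kernel.map_frestrictLe_trajMeasure_compProd_eq_map_trajMeasure
    (X := fun _ => S × A) (μ₀ := actKernel π s) (κ := nextKernel P π) (a := t)
  have h2 := congrArg (fun μ => ∫⁻ x, g x.2 ∂μ) h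
  rw [Measure.lintegral_compProd (by fun_prop), lintegral_map (by fun_prop) (by fun_prop),
    lintegral_map (by fun_prop) (by fun_prop)] at h2
  exact h2.symm

lemma lintegral_trajLaw_zero (s : S) {g : S × A → ℝ≥0∞} (hg : Measurable g) :
    ∫⁻ ω, g (ω 0) ∂(trajLaw P π s) = ∫⁻ a, g (s, a) ∂(π.1 s) := by
  let i : Finset.Iic 0 := ⟨0, Finset.mem_Iic.2 le_rfl⟩
  have hg0 : Measurable fun ω : ℕ → S × A => g (ω 0) := by fun_prop
  have key : ∀ x : Finset.Iic 0 → S × A,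
      ∫⁻ ω, g (ω 0) ∂(Kernel.traj (X := fun _ => S × A) (nextKernel P π) 0 x) = g (x i) := by
    intro x
    have h := Kernel.traj_map_frestrictLe_apply (X := fun _ => S × A)
      (κ := nextKernel P π) 0 0 x
    have h2 := congrArg (fun μ => ∫⁻ y, g (y i) ∂μ) h
    rw [lintegral_map (by fun_prop) (by fun_prop), Kernel.partialTraj_self, Kernel.id_apply,
      lintegral_dirac' _ (by fun_prop)] at h2
    exact h2
  rw [trajLaw, Kernel.trajMeasure, Measure.lintegral_bind (Kernel.aemeasurable _) hg0.aemeasurable]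
  simp_rw [key]
  rw [lintegral_map (by fun_prop) (by fun_prop)]
  exact lintegral_actKernel π hg s

lemma lintegral_trajLaw_apply (s : S) {g : S × A → ℝ≥0∞} (hg : Measurable g) (t : ℕ) :
    ∫⁻ ω, g (ω t) ∂(trajLaw P π s) = ∫⁻ a, (expNext P π)^[t] g (s, a) ∂(π.1 s) := by
  induction t generalizing g with
  | zero => exact lintegral_trajLaw_zero P π s hg
  | succ t ih =>
    rw [lintegral_trajLaw_succ P π s hg, ih (measurable_expNext P π hg),
      Function.iterate_succ_apply]

variable (γ : ℝ≥0) {c : S → A → ℝ≥0∞}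

lemma value_eq_tsum (hc : Measurable c.uncurry) (s : S) :
    value P γ c π s =
      ∑' t : ℕ, (γ : ℝ≥0∞) ^ t * ∫⁻ a, (expNext P π)^[t] c.uncurry (s, a) ∂(π.1 s) := by
  have hct : ∀ t : ℕ, Measurable fun ω : ℕ → S × A => c.uncurry (ω t) := fun t => by fun_prop
  refine (lintegral_tsum fun t => ((hct t).const_mul _).aemeasurable).trans ?_
  refine tsum_congr fun t => ?_
  rw [← lintegral_trajLaw_apply P π s hc]
  exact lintegral_const_mul _ (hct t)

lemma measurable_value (hc : Measurable c.uncurry) : Measurable (value P γ c π) := by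
  rw [funext (value_eq_tsum P π γ hc)]
  exact Measurable.tsum fun t => (measurable_lintegral_policy π
    (measurable_iterate_expNext P π hc t)).const_mul _

/-- The Bellman equation of a fixed policy: conditioning on the first state and action. -/
lemma value_eq_lintegral (hc : Measurable c.uncurry) (s : S) :
    value P γ c π s = ∫⁻ a, (c s a + γ * ∫⁻ s', value P γ c π s' ∂(P (s, a))) ∂(π.1 s) := by
  have hm := measurable_iterate_expNext P π hc
  have hm' := fun t => measurable_lintegral_policy π (hm t)
  have hnext : ∀ a, ∫⁻ s', value P γ c π s' ∂(P (s, a)) =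
      ∑' t : ℕ, (γ : ℝ≥0∞) ^ t * (expNext P π)^[t + 1] c.uncurry (s, a) := by
    intro a
    simp_rw [value_eq_tsum P π γ hc]
    rw [lintegral_tsum fun t => ((hm' t).const_mul _).aemeasurable]
    refine tsum_congr fun t => ?_
    rw [lintegral_const_mul _ (hm' t), Function.iterate_succ_apply', expNext_apply P π (hm t)]
  have hsplit : ∀ a, c s a + γ * ∫⁻ s', value P γ c π s' ∂(P (s, a)) =
      ∑' t : ℕ, (γ : ℝ≥0∞) ^ t * (expNext P π)^[t] c.uncurry (s, a) := by
    intro a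
    rw [hnext, ← ENNReal.tsum_mul_left, eq_comm, tsum_eq_zero_add' ENNReal.summable]
    simp [pow_succ', mul_assoc, Function.uncurry]
  simp_rw [hsplit]
  rw [lintegral_tsum fun t => by have := hm t; fun_prop, value_eq_tsum P π γ hc]
  refine tsum_congr fun t => (lintegral_const_mul _ ?_).symm
  exact (hm t).comp measurable_prodMk_left

/-- The value of a policy is the least solution of its Bellman inequality: the costs of the first
`N` stages are below every measurable supersolution `v`, by induction on `N`. -/
lemma value_le_of_supersolution (hc : Measurable c.uncurry) {v : S → ℝ≥0∞}
    (h : ∀ s, ∫⁻ a, (c s a + γ * ∫⁻ s', v s' ∂(P (s, a))) ∂(π.1 s) ≤ v s) (s : S) :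
    value P γ c π s ≤ v s := by
  have hm := measurable_iterate_expNext P π hc
  have hms : ∀ s t, Measurable fun a => (expNext P π)^[t] c.uncurry (s, a) :=
    fun s t => (hm t).comp measurable_prodMk_left
  have hm' := fun t => measurable_lintegral_policy π (hm t)
  rw [value_eq_tsum P π γ hc]
  refine ENNReal.tsum_le_of_sum_range_le fun N => ?_
  induction N generalizing s with
  | zero => simp
  | succ N ih =>
    refine le_trans (b := ∫⁻ a, ∑ t ∈ Finset.range (N + 1),
      (γ : ℝ≥0∞) ^ t * (expNext P π)^[t] c.uncurry (s, a) ∂(π.1 s)) (le_of_eq ?_)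
      ((lintegral_mono fun a => ?_).trans (h s))
    · rw [lintegral_finsetSum _ fun t _ => (hms s t).const_mul _]
      simp_rw [lintegral_const_mul _ (hms s _)]
    · have hN := lintegral_mono (μ := P (s, a)) ih
      rw [lintegral_finsetSum _ fun t _ => (hm' t).const_mul _] at hN
      simp_rw [lintegral_const_mul _ (hm' _), ← expNext_apply P π (hm _),
        ← Function.iterate_succ_apply' (expNext P π)] at hN
      rw [Finset.sum_range_succ', add_comm]
      simp only [pow_succ', mul_assoc, ← Finset.mul_sum, pow_zero, one_mul,
        Function.iterate_zero, id]
      exact add_le_add le_rfl (mul_le_mul_right hN _)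

lemma value_mono {c' : S → A → ℝ≥0∞} (h : ∀ s a, c s a ≤ c' s a) (s : S) :
    value P γ c π s ≤ value P γ c' π s :=
  lintegral_mono fun _ => ENNReal.tsum_le_tsum fun _ => mul_le_mul_right (h _ _) _

lemma value_lt_top_of_bounded (hγ : γ < 1) {M : ℝ≥0} (hM : ∀ s a, c s a ≤ M) (s : S) :
    value P γ c π s < ∞ := by
  refine (value_mono P π γ (c' := fun _ _ => M) hM s).trans_lt ?_
  have hγ' : (1 : ℝ≥0∞) - γ ≠ 0 := (tsub_pos_of_lt (by exact_mod_cast hγ)).ne'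
  simp only [value, lintegral_const, measure_univ, mul_one, ENNReal.tsum_mul_right,
    ENNReal.tsum_geometric]
  exact ENNReal.mul_lt_top (ENNReal.inv_lt_top.2 (pos_iff_ne_zero.2 hγ')) ENNReal.coe_lt_top

end Value

/-! ### Values under a homomorphism of decision processes -/

section Transfer

variable {S S' A : Type*} [MeasurableSpace S] [MeasurableSpace S'] [MeasurableSpace A]

/-- If `e` carries the transitions and costs of a process on `S'` to those of a process on `S`, a
policy on `S` and its pullback along `e` have the same value. -/
lemma value_pullback (P : Kernel (S × A) S) [IsMarkovKernel P] (P' : Kernel (S' × A) S')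
    [IsMarkovKernel P'] (γ : ℝ≥0) {c : S → A → ℝ≥0∞} {c' : S' → A → ℝ≥0∞}
    (hc : Measurable c.uncurry) {e : S' → S} (he : Measurable e)
    (hP : ∀ s a, P (e s, a) = (P' (s, a)).map e) (hcc : ∀ s a, c (e s) a = c' s a)
    (π : Policy S A) (s : S') :
    value P' γ c' (π.pullback e he) s = value P γ c π (e s) := by
  have hE : Measurable fun p : S' × A => (e p.1, p.2) := by fun_prop
  have hc' : c'.uncurry = fun p => c.uncurry (e p.1, p.2) := by
    ext p; exact (hcc _ _).symm
  have hc'm : Measurable c'.uncurry := hc' ▸ hc.comp hE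
  have hiter : ∀ t, (expNext P' (π.pullback e he))^[t] c'.uncurry =
      fun p => (expNext P π)^[t] c.uncurry (e p.1, p.2) := by
    intro t
    induction t with
    | zero => exact hc'
    | succ t ih =>
      have hm := measurable_iterate_expNext P π hc t
      ext p
      rw [Function.iterate_succ_apply', Function.iterate_succ_apply', ih,
        expNext_apply _ _ (g := fun p => (expNext P π)^[t] c.uncurry (e p.1, p.2)) (by fun_prop),
        expNext_apply _ _ hm, hP,
        lintegral_map (measurable_lintegral_policy π hm) he]
      rfl
  rw [value_eq_tsum _ _ _ hc'm, value_eq_tsum _ _ _ hc]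
  simp_rw [hiter]
  rfl

end Transfer

/-! ### Optimal values for finitely many actions -/

section Optimal

variable {S A : Type*} [MeasurableSpace S] [MeasurableSpace A]

/-- The Bellman optimality operator `v ↦ inf_a (c(·, a) + γ ∫ v dP(· , a))`. -/
noncomputable def bellman (P : Kernel (S × A) S) (γ : ℝ≥0) (c : S → A → ℝ≥0∞) (v : S → ℝ≥0∞) :
    S → ℝ≥0∞ :=
  fun s => ⨅ a, (c s a + γ * ∫⁻ s', v s' ∂(P (s, a)))

lemma bellman_mono (P : Kernel (S × A) S) (γ : ℝ≥0) {c c' : S → A → ℝ≥0∞} (hc : c ≤ c')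
    {v v' : S → ℝ≥0∞} (hv : v ≤ v') : bellman P γ c v ≤ bellman P γ c' v' :=
  fun s => iInf_mono fun a => add_le_add (hc s a) (mul_le_mul_right (lintegral_mono hv) _)

lemma measurable_iSup_fun {f : ℕ → S → ℝ≥0∞} (hf : ∀ n, Measurable (f n)) :
    Measurable (⨆ n, f n) := by
  have h : ⨆ n, f n = fun s => ⨆ n, f n s := by ext s; simp
  exact h ▸ Measurable.iSup hf

/-- A function with finitely many alternatives has a measurable minimizer. -/
lemma exists_measurable_argmin [Finite A] [Nonempty A] [MeasurableSingletonClass A]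
    {q : S → A → ℝ≥0∞} (hq : ∀ a, Measurable fun s => q s a) :
    ∃ f : S → A, Measurable f ∧ ∀ s a, q s (f s) ≤ q s a := by
  classical
  have := Fintype.ofFinite A
  have hq' : Measurable fun p : S × A => q p.1 p.2 := measurable_from_prod_countable_left hq
  suffices h : ∀ t : Finset A, t.Nonempty →
      ∃ f : S → A, Measurable f ∧ ∀ s, ∀ a ∈ t, q s (f s) ≤ q s a by
    obtain ⟨f, hf, h⟩ := h Finset.univ Finset.univ_nonempty
    exact ⟨f, hf, fun s a => h s a (Finset.mem_univ a)⟩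
  intro t ht
  induction ht using Finset.Nonempty.cons_induction with
  | singleton b => exact ⟨fun _ => b, measurable_const, by simp⟩
  | cons b t _ _ ih =>
    obtain ⟨f, hf, h⟩ := ih
    have hset : MeasurableSet {s | q s b ≤ q s (f s)} :=
      measurableSet_le (hq b) (hq'.comp (measurable_id.prodMk hf))
    refine ⟨fun s => if q s b ≤ q s (f s) then b else f s,
      Measurable.ite hset measurable_const hf, fun s a ha => ?_⟩
    rcases Finset.mem_cons.1 ha with rfl | ha
    · dsimp only; split_ifs with hs
      · exact le_rfl
      · exact (not_le.1 hs).le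
    · dsimp only; split_ifs with hs
      · exact hs.trans (h s a ha)
      · exact h s a ha

variable (P : Kernel (S × A) S) (γ : ℝ≥0) {c : S → A → ℝ≥0∞} {v : S → ℝ≥0∞}

lemma measurable_actionValue (hc : Measurable c.uncurry) (hv : Measurable v) (a : A) :
    Measurable fun s => c s a + γ * ∫⁻ s', v s' ∂(P (s, a)) := by
  have h1 : Measurable fun s => c s a := hc.comp measurable_prodMk_right
  have h2 : Measurable fun s => ∫⁻ s', v s' ∂(P (s, a)) :=
    (hv.lintegral_kernel (κ := P)).comp measurable_prodMk_right
  exact h1.add (h2.const_mul _)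

lemma measurable_bellman [Finite A] (hc : Measurable c.uncurry) (hv : Measurable v) :
    Measurable (bellman P γ c v) :=
  Measurable.iInf fun a => measurable_actionValue P γ hc hv a

/-- The Bellman operator commutes with increasing limits of costs and value functions: monotone
convergence, and an infimum over finitely many actions commutes with an increasing supremum. -/
lemma bellman_iSup [Finite A] {c : ℕ → S → A → ℝ≥0∞} {v : ℕ → S → ℝ≥0∞} (hc : Monotone c)
    (hv : Monotone v) (hvm : ∀ n, Measurable (v n)) :
    bellman P γ (⨆ n, c n) (⨆ n, v n) = ⨆ n, bellman P γ (c n) (v n) := by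
  ext s
  simp only [bellman, iSup_apply]
  rw [iSup_iInf_of_monotone]
  · refine iInf_congr fun a => ?_
    rw [lintegral_iSup hvm hv, ENNReal.mul_iSup]
    refine ENNReal.iSup_add_iSup_of_monotone (fun m n hmn => hc hmn s a) fun m n hmn => ?_
    exact mul_le_mul_right (lintegral_mono (hv hmn)) _
  · intro a m n hmn
    exact add_le_add (hc hmn s a) (mul_le_mul_right (lintegral_mono (hv hmn)) _)

variable [IsMarkovKernel P]

lemma optValue_mono {c' : S → A → ℝ≥0∞} (h : c ≤ c') : optValue P γ c ≤ optValue P γ c' :=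
  fun s => iInf_mono fun π => value_mono P π γ h s

/-- The value of any policy is a supersolution of the optimality equation, since a minimum over
actions is at most an average over actions. -/
lemma bellman_value_le (hc : Measurable c.uncurry) (π : Policy S A) :
    bellman P γ c (value P γ c π) ≤ value P γ c π := by
  intro s
  rw [value_eq_lintegral P π γ hc]
  calc bellman P γ c (value P γ c π) s
      = ∫⁻ _, bellman P γ c (value P γ c π) s ∂(π.1 s) := by simp
    _ ≤ _ := lintegral_mono fun a => iInf_le _ a

variable [Finite A] [Nonempty A] [MeasurableSingletonClass A]

/-- A greedy policy for a measurable supersolution `v` of the optimality equation has value at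
most `v`. -/
lemma exists_value_ofFun_le (hc : Measurable c.uncurry) (hv : Measurable v)
    (h : bellman P γ c v ≤ v) :
    ∃ (f : S → A) (hf : Measurable f), ∀ s, value P γ c (Policy.ofFun f hf) s ≤ v s := by
  obtain ⟨f, hf, hmin⟩ := exists_measurable_argmin (measurable_actionValue P γ hc hv)
  refine ⟨f, hf, value_le_of_supersolution P _ γ hc fun s => ?_⟩
  rw [Policy.ofFun, Kernel.lintegral_deterministic]
  exact (le_iInf (hmin s)).trans (h s)

lemma optValue_le (hc : Measurable c.uncurry) (hv : Measurable v) (h : bellman P γ c v ≤ v) :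
    optValue P γ c ≤ v := by
  obtain ⟨f, hf, hle⟩ := exists_value_ofFun_le P γ hc hv h
  exact fun s => (iInf_le _ _).trans (hle s)

/-- Value iteration: the optimal value is the limit `v` of the iterates of the Bellman operator
started at `0`, and therefore a measurable fixed point. The limit is a fixed point by monotone
convergence, so a greedy policy for `v` has value at most `v`; conversely the value of every policy
is a supersolution, hence bounds all iterates from above. -/
lemma optValue_eq_iSup_iterate (hc : Measurable c.uncurry) :
    optValue P γ c = ⨆ N : ℕ, (bellman P γ c)^[N] 0 ∧
      Measurable (optValue P γ c) ∧ bellman P γ c (optValue P γ c) = optValue P γ c := by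
  have hB : Monotone (bellman P γ c) := fun _ _ h => bellman_mono P γ le_rfl h
  have hmono : Monotone fun N : ℕ => (bellman P γ c)^[N] 0 :=
    hB.monotone_iterate_of_le_map fun _ => zero_le
  have hmeas : ∀ N : ℕ, Measurable ((bellman P γ c)^[N] 0) := by
    intro N
    induction N with
    | zero => exact measurable_const
    | succ N ih => rw [Function.iterate_succ_apply']; exact measurable_bellman P γ hc ih
  have hfix : bellman P γ c (⨆ N : ℕ, (bellman P γ c)^[N] 0) = ⨆ N : ℕ, (bellman P γ c)^[N] 0 := by
    have h := bellman_iSup P γ (c := fun _ => c) monotone_const hmono hmeas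
    rw [ciSup_const] at h
    simp_rw [← Function.iterate_succ_apply' (bellman P γ c)] at h
    rw [h]
    exact hmono.iSup_nat_add 1
  have hsup : Measurable (⨆ N : ℕ, (bellman P γ c)^[N] 0) := measurable_iSup_fun hmeas
  have heq : optValue P γ c = ⨆ N : ℕ, (bellman P γ c)^[N] 0 := by
    refine le_antisymm (optValue_le P γ hc hsup hfix.le) (iSup_le fun N s => ?_)
    refine le_iInf fun π => ?_
    suffices h : (bellman P γ c)^[N] 0 ≤ value P γ c π from h s
    induction N with
    | zero => exact fun _ => zero_le
    | succ N ih =>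
      rw [Function.iterate_succ_apply']
      exact (hB ih).trans (bellman_value_le P γ hc π)
  exact ⟨heq, heq ▸ hsup, heq ▸ hfix⟩

lemma measurable_optValue (hc : Measurable c.uncurry) : Measurable (optValue P γ c) :=
  (optValue_eq_iSup_iterate P γ hc).2.1

lemma bellman_optValue (hc : Measurable c.uncurry) :
    bellman P γ c (optValue P γ c) = optValue P γ c :=
  (optValue_eq_iSup_iterate P γ hc).2.2

lemma isLeast_optValue (hc : Measurable c.uncurry) (s : S) :
    IsLeast (Set.range fun a : A => c s a + γ * ∫⁻ s', optValue P γ c s' ∂(P (s, a)))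
      (optValue P γ c s) := by
  have h := congrFun (bellman_optValue P γ hc) s
  obtain ⟨a, ha⟩ := exists_eq_ciInf_of_finite
    (f := fun a : A => c s a + γ * ∫⁻ s', optValue P γ c s' ∂(P (s, a)))
  refine ⟨⟨a, ha.trans h⟩, ?_⟩
  rintro _ ⟨a, rfl⟩
  exact h.symm.trans_le (iInf_le _ a)

lemma exists_isOptimal_ofFun (hc : Measurable c.uncurry) :
    ∃ (f : S → A) (hf : Measurable f), IsOptimal P γ c (Policy.ofFun f hf) := by
  obtain ⟨f, hf, h⟩ := exists_value_ofFun_le P γ hc (measurable_optValue P γ hc)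
    (bellman_optValue P γ hc).le
  exact ⟨f, hf, fun s => le_antisymm (h s) (iInf_le _ _)⟩

/-- Optimal values are continuous along increasing costs: the supremum of the optimal values
solves the optimality equation of the limiting cost. -/
lemma optValue_iSup {c : ℕ → S → A → ℝ≥0∞} (hmono : Monotone c)
    (hc : ∀ n, Measurable (c n).uncurry) :
    optValue P γ (⨆ n, c n) = ⨆ n, optValue P γ (c n) := by
  have hV : Monotone fun n => optValue P γ (c n) := fun m n h => optValue_mono P γ (hmono h)
  have hVm := fun n => measurable_optValue P γ (hc n)
  have hcs : Measurable (⨆ n, c n).uncurry := by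
    have : (⨆ n, c n).uncurry = ⨆ n, (c n).uncurry := by ext p; simp [Function.uncurry]
    rw [this]
    exact measurable_iSup_fun hc
  refine le_antisymm (optValue_le P γ hcs (measurable_iSup_fun hVm) ?_)
    (iSup_le fun n => optValue_mono P γ (le_iSup c n))
  rw [bellman_iSup P γ hmono hV hVm]
  exact iSup_mono fun n => (bellman_optValue P γ (hc n)).le

end Optimal

end SafeLatent

theorem theorem1 {V H O : Type*}
    [Fintype V] [Nonempty V] [MeasurableSpace V] [MeasurableSingletonClass V]
    [TopologicalSpace H] [TopologicalSpace.MetrizableSpace H] [SecondCountableTopology H]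
    [MeasurableSpace H] [BorelSpace H]
    [TopologicalSpace O] [TopologicalSpace.MetrizableSpace O] [SecondCountableTopology O]
    [MeasurableSpace O] [BorelSpace O]
    (γ : ℝ≥0) (hγ_pos : 0 < γ) (hγ_lt : γ < 1)
    -- the token-space process, the embedding, and the latent process
    (Ctask : SafeLatent.TokenState V → V → ℝ≥0) (Csafety : SafeLatent.TokenState V → V → ℝ)
    (φ : SafeLatent.TokenState V → H × O)
    (Cbar : ℕ∞ → SafeLatent.LatentState H O → V → ℝ≥0∞)
    (Pbar : Kernel (SafeLatent.LatentState H O × V) (SafeLatent.LatentState H O))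
    [IsMarkovKernel Pbar]
    (hrep : SafeLatent.Represents γ Ctask Csafety φ Cbar Pbar)
    -- the latent costs increase with the penalty, with limit the cost at the infinite penalty
    (hmono : ∀ l y, Monotone fun n : ℕ => Cbar n l y)
    (hlim : ∀ l y, Tendsto (fun n : ℕ => Cbar n l y) atTop (𝓝 (Cbar ⊤ l y)))
    -- regularity of the latent costs and of the latent transition law
    (hA1 : ∀ n : ℕ, SafeLatent.IsRegularCost (Cbar n))
    (hA2 : SafeLatent.WeaklyContinuous Pbar) :
    -- (a) finiteness and the Bellman equation
    (∀ n : ℕ,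
      Measurable (SafeLatent.optValue Pbar γ (Cbar n)) ∧
      (∀ l, SafeLatent.optValue Pbar γ (Cbar n) l < ∞) ∧
      (∀ l, IsLeast
        (Set.range fun y : V =>
          Cbar n l y + γ * ∫⁻ l', SafeLatent.optValue Pbar γ (Cbar n) l' ∂(Pbar (l, y)))
        (SafeLatent.optValue Pbar γ (Cbar n) l))) ∧
    -- (a), continued: an optimal stationary policy exists, also at the infinite penalty
    (∀ n : ℕ∞, ∃ (f : SafeLatent.LatentState H O → V) (hf : Measurable f),
      SafeLatent.IsOptimal Pbar γ (Cbar n) (SafeLatent.Policy.ofFun f hf)) ∧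
    -- (b) monotone convergence of the optimal values
    (∀ l,
      Monotone (fun n : ℕ => SafeLatent.optValue Pbar γ (Cbar n) l) ∧
      Tendsto (fun n : ℕ => SafeLatent.optValue Pbar γ (Cbar n) l) atTop
        (𝓝 (SafeLatent.optValue Pbar γ (Cbar ⊤) l))) ∧
    -- (c) optimal latent policies are optimal in token space, also as the penalty tends to infinity
    (∀ πopt : ℕ∞ → SafeLatent.Policy (SafeLatent.LatentState H O) V,
      (∀ n, SafeLatent.IsOptimal Pbar γ (Cbar n) (πopt n)) →
      ∀ p : SafeLatent.AugState V,
        (∀ n : ℕ∞, IsLeast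
          (Set.range fun π : SafeLatent.Policy (SafeLatent.LatentState H O) V =>
            SafeLatent.value (SafeLatent.augKernel γ Csafety) γ (SafeLatent.augCost Ctask n)
              (π.pullback (SafeLatent.embed φ) (SafeLatent.measurable_embed φ)) p)
          (SafeLatent.value (SafeLatent.augKernel γ Csafety) γ (SafeLatent.augCost Ctask n)
            ((πopt n).pullback (SafeLatent.embed φ) (SafeLatent.measurable_embed φ)) p)) ∧
        Monotone (fun n : ℕ =>
          SafeLatent.value (SafeLatent.augKernel γ Csafety) γ (SafeLatent.augCost Ctask n)
            ((πopt n).pullback (SafeLatent.embed φ) (SafeLatent.measurable_embed φ)) p) ∧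
        Tendsto (fun n : ℕ =>
          SafeLatent.value (SafeLatent.augKernel γ Csafety) γ (SafeLatent.augCost Ctask n)
            ((πopt n).pullback (SafeLatent.embed φ) (SafeLatent.measurable_embed φ)) p) atTop
          (𝓝 (SafeLatent.value (SafeLatent.augKernel γ Csafety) γ (SafeLatent.augCost Ctask ⊤)
            ((πopt ⊤).pullback (SafeLatent.embed φ) (SafeLatent.measurable_embed φ)) p))) := by
  have hsup : Cbar ⊤ = ⨆ n : ℕ, Cbar n := by
    ext l y
    simp only [iSup_apply]
    exact tendsto_nhds_unique (hlim l y) (tendsto_atTop_iSup (hmono l y))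
  have hmonoC : Monotone fun n : ℕ => Cbar n := fun m n hmn l y => hmono l y hmn
  have hcN : ∀ n : ℕ, Measurable (Cbar n).uncurry :=
    fun n => measurable_from_prod_countable_left (hA1 n).measurable
  have hcTop : Measurable (Cbar ⊤).uncurry := by
    refine measurable_from_prod_countable_left fun y => ?_
    exact measurable_of_tendsto_metrizable (fun n : ℕ => (hA1 n).measurable y)
      (tendsto_pi_nhds.2 fun l => hlim l y)
  have hc : ∀ n : ℕ∞, Measurable (Cbar n).uncurry := fun n => by
    induction n using ENat.recTopCoe with
    | top => exact hcTop
    | coe n => exact hcN n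
  have hVmono : ∀ l, Monotone fun n : ℕ => SafeLatent.optValue Pbar γ (Cbar n) l :=
    fun l m n hmn => SafeLatent.optValue_mono Pbar γ (hmonoC hmn) l
  have hVlim : ∀ l, Tendsto (fun n : ℕ => SafeLatent.optValue Pbar γ (Cbar n) l) atTop
      (𝓝 (SafeLatent.optValue Pbar γ (Cbar ⊤) l)) := by
    intro l
    rw [hsup, SafeLatent.optValue_iSup Pbar γ hmonoC hcN, iSup_apply]
    exact tendsto_atTop_iSup (hVmono l)
  have hval : ∀ (n : ℕ∞) (π : SafeLatent.Policy (SafeLatent.LatentState H O) V)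
      (p : SafeLatent.AugState V),
      SafeLatent.value (SafeLatent.augKernel γ Csafety) γ (SafeLatent.augCost Ctask n)
        (π.pullback (SafeLatent.embed φ) (SafeLatent.measurable_embed φ)) p =
      SafeLatent.value Pbar γ (Cbar n) π (SafeLatent.embed φ p) :=
    fun n π p => SafeLatent.value_pullback Pbar _ γ (hc n) _ hrep.transition_eq (hrep.cost_eq n) π p
  refine ⟨fun n => ⟨SafeLatent.measurable_optValue Pbar γ (hcN n), fun l => ?_,
    SafeLatent.isLeast_optValue Pbar γ (hcN n)⟩,
    fun n => SafeLatent.exists_isOptimal_ofFun Pbar γ (hc n),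
    fun l => ⟨hVmono l, hVlim l⟩, fun πopt hopt p => ?_⟩
  · obtain ⟨M, hM⟩ := (hA1 n).bounded
    obtain ⟨f, hf, hfo⟩ := SafeLatent.exists_isOptimal_ofFun Pbar γ (hcN n)
    rw [← hfo l]
    exact SafeLatent.value_lt_top_of_bounded Pbar _ γ hγ_lt hM l
  · simp_rw [hval, hopt _ (SafeLatent.embed φ p)]
    refine ⟨fun n => ⟨⟨πopt n, hopt n _⟩, ?_⟩, hVmono _, hVlim _⟩
    rintro _ ⟨π, rfl⟩
    exact iInf_le _ π
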